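/- Consider $U(1)$-symmetric nonrelativistic bosons in vacuum in $d$ space dimensions, in the imaginary-time functional renormalization group. **Propagator.** For every scale $k>0$ let $G_k(x,y)$, with $x=(\tau_x,\mathbf x)$ and $y=(\tau_y,\mathbf y)$, be the regularized propagator, i.e. the Green function of $\partial_\tau-\nabla^2/(2M)-\mu+R_k$. The regulator $R_k$ is assumed to be such that $G_k$ is differentiable in $k$ and vanishes for $\tau_x\le\tau_y$. **Vertices.** Expand the interaction part of the flowing action (the flowing action minus the microscopic quadratic part) as $\sum_{q\ge1}(q!)^{-2}\int\Gamma_{k,q}(y_1,\dots,y_q;x_1,\dots,x_q)\,\phi^*(y_1)\cdots\phi^*(y_q)\,\phi(x_1)\cdots\phi(x_q)$, where each $q$-body vertex $\Gamma_{k,q}$ is a locally finite complex measure, symmetric in the outgoing points $y_i$ and in the incoming points $x_i$. (For a given $q$ these measures are taken to have densities with respect to a fixed $\sigma$-finite measure, which may charge coinciding points; $\Gamma_{k,1}$ is the self-energy.) The vertices obey the flow equation $$\partial_k\Gamma_k=\tfrac12\tilde\partial_k\operatorname{Tr}\log\bigl(\Gamma_k^{(2)}+R_k\bigr),$$ where $\tilde\partial_k$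 acts on $R_k$ only. Expanded in powers of the fields, this is a sum of one-loop diagrams with lines $G_k$, one of them replaced by $\partial_kG_k$. For $k\to\infty$ the vertices approach microscopic interactions of two or more bodies that are instantaneous (all times equal), and they are generated from these by the flow: for each $k$ they lie in the smallest class that contains the microscopic interactions and is closed under finite steps $\Gamma\mapsto\Gamma+\varepsilon\cdot(\text{right-hand side of the flow equation at some scale})$ and under weak limits. **Closeability.** A configuration of $q$ outgoing points $y_i$ and $q$ incoming points $x_i$ is *at least $j$-closeable* if $j$ distinct outgoing points can be paired with $j$ distinct incoming points such that $\tau_y<\tau_x$ in each pair, and *$j$-closeable* if it is at least $j$-closeable but not at least $(j+1)$-closeable. The (at least) $j$-closeable part of a vertex is its restriction to the (at least) $j$-closeable configurations. **Theorem (decoupling).** Let $n,m\ge0$ with $n+m\ge1$. The right-hand side of the flow equation for the $m$-closeable part of the $(n+m)$-body vertex depends only on 1. the regularized propagator $G_k$ and its scale derivative, 2. the $q$-body vertices with $2\le q\le n$, and 3. the at least $j$-closeable parts of the $(n+j)$-body vertices with $0<j\le m+1$. That is, the $m$-closeable part of the right-hand side at order $n+m$ is unchanged if all other vertices and parts of vertices,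 the self-energy included, are set to zero; and at equal $G_k$ and $k$ it coincides for any two families of vertices, each generated by the flow from some microscopic interactions, that agree in 2. and 3. -/

import Mathlib

open MeasureTheory Filter Topology
open scoped ContDiff

noncomputable section

namespace VacuumFRG

/-- Points `(τ, x)`: imaginary time and position in `d` space dimensions. -/
abbrev Pt (d : ℕ) : Type := ℝ × EuclideanSpace ℝ (Fin d)

/-- Positions of the legs of an `N`-body vertex: first the `N` outgoing legs (arguments of `φ*`),
then the `N` incoming legs (arguments of `φ`). -/
abbrev Legs (d N : ℕ) : Type := (Fin N → Pt d) × (Fin N → Pt d)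

/-- The unordered collection of the points of a tuple. -/
def pts {d N : ℕ} (y : Fin N → Pt d) : Multiset (Pt d) := Finset.univ.val.map y

/-- Functions of an unordered collection of outgoing and one of incoming points, i.e. functions
with the permutation symmetry of bosons. As a family of vertices, `Γ` restricted to collections
of `q` outgoing and `q` incoming points is the density of the `q`-body vertex, and the one-body
component is the deviation from the microscopic one (the self-energy). -/
abbrev BoseFun (d : ℕ) : Type := Multiset (Pt d) → Multiset (Pt d) → ℂ

/-- `m` outgoing legs can be joined with `m` incoming legs by lines that run strictly forward in
time (from the outgoing to the incoming leg). -/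
def IsCloseable {d : ℕ} (m : ℕ) (A B : Multiset (Pt d)) : Prop :=
  ∃ A' ≤ A, ∃ B' ≤ B, A'.card = m ∧ Multiset.Rel (fun y x => y.1 < x.1) A' B'

open Classical in
/-- The `m`-closeable part: the restriction to the time configurations in which `m`, but not
`m + 1`, pairs of legs can be closed. -/
def closeablePart {d : ℕ} (m : ℕ) (Γ : BoseFun d) : BoseFun d := fun A B =>
  if IsCloseable m A B ∧ ¬ IsCloseable (m + 1) A B then Γ A B else 0

open Classical in
/-- What remains of a family of vertices if one keeps only the `q`-body vertices with
`2 ≤ q ≤ n` and the at least `j`-closeable part of the `(n + j)`-body vertices with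
`0 < j ≤ m + 1`, and sets everything else to zero. -/
def relevantPart {d : ℕ} (n m : ℕ) (Γ : BoseFun d) : BoseFun d := fun A B =>
  if A.card = B.card ∧ ((2 ≤ A.card ∧ A.card ≤ n) ∨
      ∃ j, 0 < j ∧ j ≤ m + 1 ∧ A.card = n + j ∧ IsCloseable j A B)
  then Γ A B else 0

/-- Test functions for `N`-body vertices: bounded, measurable, of bounded support. -/
def IsTest {d : ℕ} (N : ℕ) (ψ : BoseFun d) : Prop :=
  Measurable (fun z : Legs d N => ψ (pts z.1) (pts z.2)) ∧
  (∃ C : ℝ, ∀ A B, ‖ψ A B‖ ≤ C) ∧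
  ∃ K : Set (Pt d), Bornology.IsBounded K ∧ ∀ A B, ψ A B ≠ 0 → ∀ x ∈ A + B, x ∈ K

/-- The `N`-body vertex is the measure with density `Γ` with respect to the reference measure
`ref N`, which may charge sets of coinciding legs (as it has to for instantaneous or contact
interactions). This predicate says that these measures are locally finite. -/
def IsVertexFamily {d : ℕ} (ref : ∀ N, Measure (Legs d N)) (Γ : BoseFun d) : Prop :=
  ∀ N, Measurable (fun z : Legs d N => Γ (pts z.1) (pts z.2)) ∧
    ∀ K : Set (Pt d), Bornology.IsBounded K →
      IntegrableOn (fun z : Legs d N => Γ (pts z.1) (pts z.2))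
        {z | ∀ i, z.1 i ∈ K ∧ z.2 i ∈ K} (ref N)

/-- The order-`(φ*φ)^N` part of the action, `(N!)⁻² ∫ Γ_N φ*⋯φ* φ⋯φ`, with a test function in
place of the product of fields. -/
def pairing {d : ℕ} (ref : ∀ N, Measure (Legs d N)) (N : ℕ) (Γ ψ : BoseFun d) : ℂ :=
  (1 / ((N.factorial : ℂ) ^ 2)) *
    ∫ z : Legs d N, Γ (pts z.1) (pts z.2) * ψ (pts z.1) (pts z.2) ∂(ref N)

/-- The transpose of the microscopic inverse propagator `∂_τ - ∇²/(2M) - μ`. -/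
def microTranspose {d : ℕ} (M μ : ℝ) (f : Pt d → ℂ) : Pt d → ℂ := fun x =>
  - deriv (fun s => f (s, x.2)) x.1
  - ((1 / (2 * M) : ℝ) : ℂ) * Laplacian.laplacian (fun v => f (x.1, v)) x.2
  - (μ : ℂ) * f x

/-- A regularization of nonrelativistic bosons in vacuum: a regulator `R_k`, given through its
transpose `RT k` on test functions, and the regularized propagator `G k x y = ⟨φ(x) φ*(y)⟩`, i.e.
the Green function of `∂_τ - ∇²/(2M) - μ + R_k`. The regulator is such that this propagator runs
only forward in time; it is taken to be zero at equal times. -/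
structure Regularization (d : ℕ) where
  M : ℝ
  μ : ℝ
  M_pos : 0 < M
  RT : ℝ → (Pt d → ℂ) →ₗ[ℂ] (Pt d → ℂ)
  G : ℝ → Pt d → Pt d → ℂ
  measurable_G : ∀ k, 0 < k → Measurable (fun p : Pt d × Pt d => G k p.1 p.2)
  green : ∀ k, 0 < k → ∀ f : Pt d → ℂ, ContDiff ℝ ∞ f → HasCompactSupport f → ∀ y,
    Integrable (fun x => G k x y * (microTranspose M μ f x + RT k f x)) ∧
      ∫ x, G k x y * (microTranspose M μ f x + RT k f x) = f y
  differentiable_G : ∀ k, 0 < k → ∀ x y, DifferentiableAt ℝ (fun κ => G κ x y) k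
  retarded : ∀ k, 0 < k → ∀ x y, x.1 ≤ y.1 → G k x y = 0

/-- The regulator scale derivative of the regularized propagator. -/
def Regularization.Gdot {d : ℕ} (P : Regularization d) (k : ℝ) (x y : Pt d) : ℂ :=
  deriv (fun κ => P.G κ x y) k

/-- The factor of an internal line that joins the leg `u` of one vertex with the leg `v` of
another (or the same) vertex; `Sum.inl` are outgoing and `Sum.inr` incoming legs. Only an
outgoing and an incoming leg can be joined. -/
def lineFactor {d q q' : ℕ} (g : Pt d → Pt d → ℂ) (z : Legs d q) (z' : Legs d q') :
    Fin q ⊕ Fin q → Fin q' ⊕ Fin q' → ℂ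
  | Sum.inl a, Sum.inr b => g (z'.2 b) (z.1 a)
  | Sum.inr b, Sum.inl a => g (z.2 b) (z'.1 a)
  | Sum.inl _, Sum.inl _ => 0
  | Sum.inr _, Sum.inr _ => 0

/-- The external outgoing points of a loop of vertices in which the legs `l i` and `ρ i` of the
vertex `i` are internal. -/
def extOut {d r : ℕ} {q : Fin r → ℕ} (l ρ : ∀ i, Fin (q i) ⊕ Fin (q i))
    (z : ∀ i, Legs d (q i)) : Multiset (Pt d) :=
  ∑ i, (Finset.univ.filter
    (fun a : Fin (q i) => Sum.inl a ≠ l i ∧ Sum.inl a ≠ ρ i)).val.map (z i).1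

/-- The external incoming points. -/
def extIn {d r : ℕ} {q : Fin r → ℕ} (l ρ : ∀ i, Fin (q i) ⊕ Fin (q i))
    (z : ∀ i, Legs d (q i)) : Multiset (Pt d) :=
  ∑ i, (Finset.univ.filter
    (fun b : Fin (q i) => Sum.inr b ≠ l i ∧ Sum.inr b ≠ ρ i)).val.map (z i).2

/-- A one-loop diagram with `r + 1` vertices of `q i` bodies: line `i` joins the leg `ρ i` of
vertex `i` with the leg `l (i + 1)` of vertex `i + 1` (cyclically), line `e` carries the scale
derivative of the propagator, and the external legs are paired with `ψ`. -/
def loopDiagram {d : ℕ} (P : Regularization d) (ref : ∀ N, Measure (Legs d N))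
    [∀ N, SigmaFinite (ref N)] (k : ℝ) (Γ ψ : BoseFun d) (r : ℕ) (q : Fin (r + 1) → ℕ)
    (l ρ : ∀ i, Fin (q i) ⊕ Fin (q i)) (e : Fin (r + 1)) : ℂ :=
  ∫ z : ∀ i, Legs d (q i),
    (∏ i, Γ (pts (z i).1) (pts (z i).2)) *
    (∏ i, lineFactor (if i = e then P.Gdot k else P.G k) (z i) (z (i + 1)) (ρ i) (l (i + 1))) *
    ψ (extOut l ρ z) (extIn l ρ z)
    ∂(Measure.pi fun i => ref (q i))

/-- The right-hand side of the flow equation, at order `(φ*φ)^N` in the fields and paired with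
`ψ`. This is the field expansion of `½ ∂̃_k Tr log (Γ_k^{(2)} + R_k)`, that is of
`∑_r (-1)^r / (2 (r + 1)) ∂̃_k Tr (G F)^{r+1}`, where `F` is the matrix of second functional
derivatives (with respect to `φ` and `φ*`) of `∑_q (q!)⁻² ∫ Γ_q φ*⋯φ* φ⋯φ` and `∂̃_k` acts on the
propagators `G`. The sum over `l`, `ρ` runs over the legs on which the two derivatives act. -/
def flowRHS {d : ℕ} (P : Regularization d) (ref : ∀ N, Measure (Legs d N))
    [∀ N, SigmaFinite (ref N)] (k : ℝ) (Γ : BoseFun d) (N : ℕ) (ψ : BoseFun d) : ℂ :=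
  ∑' r : ℕ, ((-1 : ℂ) ^ r / (2 * ((r : ℂ) + 1))) *
    ∑ q ∈ Finset.piAntidiag (Finset.univ : Finset (Fin (r + 1))) (N + (r + 1)),
      (∏ i, 1 / (((q i).factorial : ℂ) ^ 2)) *
        ∑ l : (∀ i, Fin (q i) ⊕ Fin (q i)), ∑ ρ : (∀ i, Fin (q i) ⊕ Fin (q i)),
          if ∀ i, l i ≠ ρ i then ∑ e, loopDiagram P ref k Γ ψ r q l ρ e else 0

/-- The interaction part of a microscopic action: instantaneous interactions of two or more
bodies. -/
structure IsMicroscopic {d : ℕ} (ref : ∀ N, Measure (Legs d N)) (S : BoseFun d) : Prop where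
  isVertexFamily : IsVertexFamily ref S
  instantaneous : ∀ A B, S A B ≠ 0 →
    A.card = B.card ∧ 2 ≤ A.card ∧ ∃ t : ℝ, ∀ x ∈ A + B, x.1 = t

/-- The families of vertices generated by the flow equation from the microscopic interactions
`S`: those obtained from `S` by finite steps of the flow and by limits. The solution of the flow
equation with microscopic data `S` is the limit of such steps (Euler polygons); an infinite
hierarchy of differential equations does not by itself determine its solution. -/
inductive FlowGenerated {d : ℕ} (P : Regularization d) (ref : ∀ N, Measure (Legs d N))
    [∀ N, SigmaFinite (ref N)] (S : BoseFun d) : BoseFun d → Prop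
  | micro : FlowGenerated P ref S S
  | step (Γ Γ' : BoseFun d) (k ε : ℝ) : 0 < k → FlowGenerated P ref S Γ → IsVertexFamily ref Γ' →
      (∀ N, 1 ≤ N → ∀ ψ, IsTest N ψ →
        pairing ref N Γ' ψ = pairing ref N Γ ψ + (ε : ℂ) * flowRHS P ref k Γ N ψ) →
      FlowGenerated P ref S Γ'
  | limit (Γs : ℕ → BoseFun d) (Γ : BoseFun d) : (∀ i, FlowGenerated P ref S (Γs i)) →
      IsVertexFamily ref Γ →
      (∀ N, 1 ≤ N → ∀ ψ, IsTest N ψ →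
        Tendsto (fun i => pairing ref N (Γs i) ψ) atTop (𝓝 (pairing ref N Γ ψ))) →
      FlowGenerated P ref S Γ

/-- `Γ` is the scale dependent family of one-particle irreducible vertices of the theory with
microscopic interactions `S`: it obeys the flow equation at every scale `k > 0`, approaches `S`
for `k → ∞`, and is generated from `S` by the flow. -/
structure IsFlow {d : ℕ} (P : Regularization d) (ref : ∀ N, Measure (Legs d N))
    [∀ N, SigmaFinite (ref N)] (S : BoseFun d) (Γ : ℝ → BoseFun d) : Prop where
  isMicroscopic : IsMicroscopic ref S
  generated : ∀ k, 0 < k → FlowGenerated P ref S (Γ k)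
  flow : ∀ N, 1 ≤ N → ∀ ψ, IsTest N ψ → ∀ k, 0 < k →
    HasDerivAt (fun κ => pairing ref N (Γ κ) ψ) (flowRHS P ref k (Γ k) N ψ) k
  initial : ∀ N, 1 ≤ N → ∀ ψ, IsTest N ψ →
    Tendsto (fun k => pairing ref N (Γ k) ψ) atTop (𝓝 (pairing ref N S ψ))

end VacuumFRG

end

/-!
Count the particles present at each time. An `(n + m)`-body configuration is at least
`m`-closeable exactly when at most `n` particles are ever present: in that case the `m` earliest
outgoing points precede, in order, the `m` latest incoming ones. Joining an outgoing with a later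
incoming point fills the gap in which that particle is absent, so external legs have at least as
many particles present as the loop they belong to. Hence the flow preserves the property of
instantaneous interactions that the number of particles is never negative and at some time at
least two, and this property carries over to weak limits.

In a loop of `r + 1` such vertices with `m`-closeable external legs, the `r + 1` internal lines and
the `m` external closings together join all but `n` of the `n + m + r + 1` pairs of legs. At most
`n` particles are therefore present in the loop, and in each of its vertices, so that a vertex of
`n + j` bodies is at least `j`-closeable. Each vertex has at least two bodies, which excludes the
self-energy, and the remaining ones leave at most `n + m + 1` bodies for any single vertex.
-/

namespace VacuumFRG

section Counting

theorem countP_le_countP_of_rel {α β : Type*} {p : β → Prop} {q : α → Prop} [DecidablePred p]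
    [DecidablePred q] {A : Multiset α} {B : Multiset β}
    (h : Multiset.Rel (fun a b => p b → q a) A B) : B.countP p ≤ A.countP q := by
  induction h with
  | zero => simp
  | @cons a b as bs hab _ ih =>
    rw [Multiset.countP_cons, Multiset.countP_cons]
    split_ifs with hp hq <;> first | omega | exact absurd (hab hp) hq

theorem countP_le_countP_of_imp {α : Type*} {p q : α → Prop} [DecidablePred p] [DecidablePred q]
    {A : Multiset α} (h : ∀ a ∈ A, p a → q a) : A.countP p ≤ A.countP q :=
  countP_le_countP_of_rel (Multiset.rel_refl_of_refl_on h)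

theorem exists_mem_countP_le_eq {α β : Type*} [LinearOrder β] (f : α → β) {A : Multiset α} {t : β}
    (h : 0 < A.countP (f · ≤ t)) :
    ∃ s ∈ A, f s ≤ t ∧ A.countP (f · ≤ f s) = A.countP (f · ≤ t) := by
  classical
  obtain ⟨a, haA, hat⟩ := Multiset.countP_pos.1 h
  obtain ⟨s, hs, hmax⟩ := (A.toFinset.filter (f · ≤ t)).exists_max_image f
    ⟨a, by simp [haA, hat]⟩
  simp only [Finset.mem_filter, Multiset.mem_toFinset] at hs hmax
  exact ⟨s, hs.1, hs.2, Multiset.countP_congr rfl fun x hx =>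
    propext ⟨fun hxs => hxs.trans hs.2, fun hxt => hmax x ⟨hx, hxt⟩⟩⟩

theorem rel_singleton {α β : Type*} {R : α → β → Prop} {a : α} {b : β} (h : R a b) :
    Multiset.Rel R {a} {b} :=
  Multiset.Rel.cons h Multiset.Rel.zero

theorem rel_sum {ι α β : Type*} {R : α → β → Prop} {A : ι → Multiset α} {B : ι → Multiset β}
    (s : Finset ι) (h : ∀ i ∈ s, Multiset.Rel R (A i) (B i)) :
    Multiset.Rel R (∑ i ∈ s, A i) (∑ i ∈ s, B i) := by
  classical
  induction s using Finset.induction_on with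
  | empty => exact Multiset.Rel.zero
  | insert i s hi ih =>
    rw [Finset.sum_insert hi, Finset.sum_insert hi]
    exact (h i (Finset.mem_insert_self i s)).add
      (ih fun j hj => h j (Finset.mem_insert_of_mem hj))

end Counting

section Occupation

variable {d : ℕ}

/-- The number of particles present at time `t` in a process with outgoing points `A` and incoming
points `B`. A particle that enters or leaves at `t` counts as present at `t`, so that an
instantaneous `q`-body interaction has `q` particles present. -/
noncomputable def occupation (t : ℝ) (A B : Multiset (Pt d)) : ℤ :=
  (B.countP fun x => x.1 ≤ t : ℕ) - (A.countP fun y => y.1 < t : ℕ)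

theorem occupation_add (t : ℝ) (A A' B B' : Multiset (Pt d)) :
    occupation t (A + A') (B + B') = occupation t A B + occupation t A' B' := by
  simp only [occupation, Multiset.countP_add, Nat.cast_add]
  ring

theorem occupation_sum {ι : Type*} (t : ℝ) (s : Finset ι) (A B : ι → Multiset (Pt d)) :
    occupation t (∑ i ∈ s, A i) (∑ i ∈ s, B i) = ∑ i ∈ s, occupation t (A i) (B i) := by
  simp only [occupation, ← Multiset.coe_countPAddMonoidHom, map_sum, Nat.cast_sum,
    Finset.sum_sub_distrib]

theorem occupation_le_occupation_sum {ι : Type*} {t : ℝ} {s : Finset ι}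
    {A B : ι → Multiset (Pt d)} (h : ∀ i ∈ s, 0 ≤ occupation t (A i) (B i)) {i : ι} (hi : i ∈ s) :
    occupation t (A i) (B i) ≤ occupation t (∑ i ∈ s, A i) (∑ i ∈ s, B i) := by
  rw [occupation_sum]
  exact Finset.single_le_sum h hi

theorem occupation_le_card (t : ℝ) (A B : Multiset (Pt d)) : occupation t A B ≤ B.card := by
  have := B.countP_le_card fun x => x.1 ≤ t
  rw [occupation]
  omega

theorem occupation_nonpos_of_rel {A B : Multiset (Pt d)}
    (h : Multiset.Rel (fun y x => y.1 < x.1) A B) (t : ℝ) : occupation t A B ≤ 0 := by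
  have : B.countP (fun x => x.1 ≤ t) ≤ A.countP fun y => y.1 < t :=
    countP_le_countP_of_rel (h.mono fun _ _ _ _ hyx hxt => hyx.trans_le hxt)
  rw [occupation]
  omega

-- Between `t` and the next incoming point the occupation does not increase.
theorem forall_occupation_nonneg_iff_rat {A B : Multiset (Pt d)} :
    (∀ t, 0 ≤ occupation t A B) ↔ ∀ t : ℚ, 0 ≤ occupation t A B := by
  refine ⟨fun h t => h t, fun h t => ?_⟩
  have no_arrival : ∀ᶠ s in 𝓝[>] t, ∀ x ∈ B.toFinset, x.1 ≤ s → x.1 ≤ t := by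
    refine (Finset.eventually_all _).2 fun x _ => ?_
    rcases le_or_gt x.1 t with hxt | htx
    · exact Eventually.of_forall fun _ _ => hxt
    · filter_upwards [Ioo_mem_nhdsGT htx] with s hs hxs using absurd hxs (not_le.2 hs.2)
  obtain ⟨u, htu, hu⟩ := mem_nhdsGT_iff_exists_Ioo_subset.1 no_arrival
  obtain ⟨s, hts, hsu⟩ := exists_rat_btwn (Set.mem_Ioi.1 htu)
  have hB : B.countP (fun x => x.1 ≤ (s : ℝ)) ≤ B.countP fun x => x.1 ≤ t :=
    countP_le_countP_of_imp fun x hx => hu ⟨hts, hsu⟩ x (Multiset.mem_toFinset.2 hx)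
  have hA : A.countP (fun y => y.1 < t) ≤ A.countP fun y => y.1 < (s : ℝ) :=
    countP_le_countP_of_imp fun y _ hy => hy.trans hts
  have hs := h s
  simp only [occupation] at hs ⊢
  omega

-- The occupation increases only at incoming points.
theorem exists_le_occupation_iff_mem {c : ℤ} (hc : 0 < c) {A B : Multiset (Pt d)} :
    (∃ t, c ≤ occupation t A B) ↔ ∃ s ∈ B, c ≤ occupation s.1 A B := by
  refine ⟨fun ⟨t, ht⟩ => ?_, fun ⟨s, _, hs⟩ => ⟨s.1, hs⟩⟩
  simp only [occupation] at ht ⊢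
  obtain ⟨s, hsB, hst, hB⟩ := exists_mem_countP_le_eq (fun x : Pt d => x.1) (A := B) (t := t)
    (by omega)
  have hA : A.countP (fun y => y.1 < s.1) ≤ A.countP fun y => y.1 < t :=
    countP_le_countP_of_imp fun y _ hy => hy.trans_le hst
  exact ⟨s, hsB, by omega⟩

end Occupation

section Points

variable {d N : ℕ}

theorem card_pts (y : Fin N → Pt d) : (pts y).card = N := by
  simp [pts]

theorem card_pts_eq_card_pts (z : Legs d N) : (pts z.1).card = (pts z.2).card :=
  (card_pts _).trans (card_pts _).symm

theorem mem_pts {y : Fin N → Pt d} {x : Pt d} : x ∈ pts y ↔ ∃ i, y i = x := by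
  simp only [pts, Multiset.mem_map, Finset.mem_val, Finset.mem_univ, true_and]

theorem countP_pts (p : Pt d → Prop) [DecidablePred p] (y : Fin N → Pt d) :
    (pts y).countP p = (Finset.univ.filter fun i => p (y i)).card := by
  rw [pts, Multiset.countP_map]
  rfl

theorem pts_comp_le {m : ℕ} (y : Fin N → Pt d) (f : Fin m ↪ Fin N) : pts (y ∘ f) ≤ pts y := by
  rw [pts, ← Multiset.map_map]
  exact Multiset.map_le_map (Finset.val_le_iff.2 (Finset.subset_univ (Finset.univ.map f)))

theorem exists_monotone_pts_eq {A : Multiset (Pt d)} (h : A.card = N) :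
    ∃ y : Fin N → Pt d, Monotone (fun i => (y i).1) ∧ pts y = A := by
  obtain ⟨L, rfl⟩ := Quot.exists_rep A
  obtain rfl : L.length = N := h
  refine ⟨L.get ∘ Tuple.sort fun i => (L.get i).1, Tuple.monotone_sort fun i => (L.get i).1, ?_⟩
  rw [pts, ← Multiset.map_map, Multiset.map_univ_val_equiv, Fin.univ_val_map, List.ofFn_get]
  rfl

end Points

section Closing

variable {d : ℕ} {A B A' B' : Multiset (Pt d)} {c m n : ℕ}

/-- Joining `c` outgoing points with `c` incoming ones by lines that run strictly forward in time
takes the outgoing points `A` and incoming points `B` to `A'` and `B'`. -/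
def IsForwardClosing (c : ℕ) (A B A' B' : Multiset (Pt d)) : Prop :=
  ∃ Y X, Y.card = c ∧ Multiset.Rel (fun y x => y.1 < x.1) Y X ∧ A = A' + Y ∧ B = B' + X

theorem isCloseable_iff_exists_isForwardClosing :
    IsCloseable m A B ↔ ∃ A' B', IsForwardClosing m A B A' B' := by
  constructor
  · rintro ⟨Y, hY, X, hX, hm, hYX⟩
    exact ⟨A - Y, B - X, Y, X, hm, hYX, (tsub_add_cancel_of_le hY).symm,
      (tsub_add_cancel_of_le hX).symm⟩
  · rintro ⟨A', B', Y, X, hm, hYX, rfl, rfl⟩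
    exact ⟨Y, Multiset.le_add_left _ _, X, Multiset.le_add_left _ _, hm, hYX⟩

theorem IsForwardClosing.trans {A'' B'' : Multiset (Pt d)} (h : IsForwardClosing c A B A' B')
    (h' : IsForwardClosing m A' B' A'' B'') : IsForwardClosing (c + m) A B A'' B'' := by
  obtain ⟨Y, X, hc, hYX, rfl, rfl⟩ := h
  obtain ⟨Y', X', hm, hYX', rfl, rfl⟩ := h'
  exact ⟨Y + Y', X + X', by rw [Multiset.card_add, hc, hm], hYX.add hYX', by abel, by abel⟩

theorem IsForwardClosing.isCloseable_add (h : IsForwardClosing c A B A' B')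
    (hm : IsCloseable m A' B') : IsCloseable (c + m) A B := by
  obtain ⟨A'', B'', h'⟩ := isCloseable_iff_exists_isForwardClosing.1 hm
  exact isCloseable_iff_exists_isForwardClosing.2 ⟨A'', B'', h.trans h'⟩

theorem IsForwardClosing.occupation_le (h : IsForwardClosing c A B A' B') (t : ℝ) :
    occupation t A B ≤ occupation t A' B' := by
  obtain ⟨Y, X, -, hYX, rfl, rfl⟩ := h
  rw [occupation_add]
  exact add_le_of_nonpos_right (occupation_nonpos_of_rel hYX t)

theorem IsForwardClosing.card_eq (h : IsForwardClosing c A B A' B') :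
    B.card = B'.card + c := by
  obtain ⟨Y, X, hc, hYX, -, rfl⟩ := h
  rw [Multiset.card_add, ← Multiset.card_eq_card_of_rel hYX, hc]

theorem IsCloseable.le_card (h : IsCloseable m A B) : m ≤ B.card := by
  obtain ⟨A', B', h⟩ := isCloseable_iff_exists_isForwardClosing.1 h
  exact h.card_eq ▸ Nat.le_add_left m _

theorem IsCloseable.occupation_add_le_card (h : IsCloseable m A B) (t : ℝ) :
    occupation t A B + m ≤ B.card := by
  obtain ⟨A', B', h⟩ := isCloseable_iff_exists_isForwardClosing.1 h
  have := (h.occupation_le t).trans (occupation_le_card t A' B')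
  rw [h.card_eq]
  push_cast
  omega

theorem fst_lt_fst_of_occupation_le {y x : Fin (n + m) → Pt d} (hy : Monotone fun i => (y i).1)
    (hx : Monotone fun i => (x i).1) (h : ∀ t, occupation t (pts y) (pts x) ≤ n) (i : Fin m) :
    (y (i.castLE (Nat.le_add_left m n))).1 < (x (i.natAdd n)).1 := by
  by_contra! hxy
  set t := (x (i.natAdd n)).1
  have arrived : n + i + 1 ≤ (Finset.univ.filter fun b => (x b).1 ≤ t).card :=
    calc n + i + 1 = (Finset.Iic (i.natAdd n)).card := by rw [Fin.card_Iic, Fin.val_natAdd]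
      _ ≤ _ := Finset.card_le_card fun b hb => by simpa using hx (Finset.mem_Iic.1 hb)
  have departed : (Finset.univ.filter fun a => (y a).1 < t).card ≤ i :=
    calc _ ≤ (Finset.Iio (i.castLE (Nat.le_add_left m n))).card :=
          Finset.card_le_card fun a ha => Finset.mem_Iio.2 <| lt_of_not_ge fun hia =>
            absurd (Finset.mem_filter.1 ha).2 (not_lt.2 (hxy.trans (hy hia)))
      _ = i := by rw [Fin.card_Iio, Fin.val_castLE]
  have := h t
  rw [occupation, countP_pts, countP_pts] at this
  omega

-- The `m` earliest outgoing points are joined, in order, with the `m` latest incoming ones.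
theorem isCloseable_of_occupation_le (hA : A.card = n + m) (hB : B.card = n + m)
    (h : ∀ t, occupation t A B ≤ n) : IsCloseable m A B := by
  obtain ⟨y, hy, rfl⟩ := exists_monotone_pts_eq hA
  obtain ⟨x, hx, rfl⟩ := exists_monotone_pts_eq hB
  refine ⟨_, pts_comp_le y (Fin.castLEEmb (Nat.le_add_left m n)), _,
    pts_comp_le x (Fin.natAddEmb n), card_pts _, ?_⟩
  rw [pts, pts, Multiset.rel_map]
  exact Multiset.rel_refl_of_refl_on fun i _ => fst_lt_fst_of_occupation_le hy hx h i

theorem isCloseable_iff_forall_occupation_le (hA : A.card = n + m) (hB : B.card = n + m) :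
    IsCloseable m A B ↔ ∀ t, occupation t A B ≤ n := by
  refine ⟨fun h t => ?_, isCloseable_of_occupation_le hA hB⟩
  have := h.occupation_add_le_card t
  omega

theorem relevantPart_eq_self_of_occupation_le (hAB : A.card = B.card) (h2 : 2 ≤ B.card)
    (hcard : B.card ≤ n + m + 1) (h : ∀ t, occupation t A B ≤ n) (Γ : BoseFun d) :
    relevantPart n m Γ A B = Γ A B := by
  refine if_pos ⟨hAB, ?_⟩
  rw [hAB]
  rcases le_or_gt B.card n with hle | hlt
  · exact Or.inl ⟨h2, hle⟩
  · obtain ⟨j, hj⟩ := Nat.exists_eq_add_of_le hlt.le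
    exact Or.inr ⟨j, by omega, by omega, hj, isCloseable_of_occupation_le (hAB.trans hj) hj h⟩

theorem isCloseable_of_closeablePart_ne_zero {ψ : BoseFun d} (h : closeablePart m ψ A B ≠ 0) :
    IsCloseable m A B := by
  by_contra hm
  exact h (if_neg fun h => hm h.1)

end Closing

section Causal

variable {d : ℕ}

/-- At no time have more particles left than have entered, and at some time at least two particles
are present. This invariant of the flow is what excludes the self-energy and loops in which a
vertex has more particles present than the external legs. -/
def IsCausal (A B : Multiset (Pt d)) : Prop :=
  (∀ t, 0 ≤ occupation t A B) ∧ ∃ t, 2 ≤ occupation t A B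

theorem IsCausal.two_le_card {A B : Multiset (Pt d)} (h : IsCausal A B) : 2 ≤ B.card := by
  obtain ⟨t, ht⟩ := h.2
  exact_mod_cast ht.trans (occupation_le_card t A B)

theorem IsForwardClosing.isCausal {c : ℕ} {A B A' B' : Multiset (Pt d)}
    (h : IsForwardClosing c A B A' B') (hAB : IsCausal A B) : IsCausal A' B' :=
  ⟨fun t => (hAB.1 t).trans (h.occupation_le t), hAB.2.imp fun t ht => ht.trans (h.occupation_le t)⟩

theorem isCausal_sum {ι : Type*} {s : Finset ι} (hs : s.Nonempty) {A B : ι → Multiset (Pt d)}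
    (h : ∀ i ∈ s, IsCausal (A i) (B i)) : IsCausal (∑ i ∈ s, A i) (∑ i ∈ s, B i) := by
  obtain ⟨i, hi⟩ := hs
  have hle := fun t => occupation_le_occupation_sum (fun j hj => (h j hj).1 t) hi
  exact ⟨fun t => ((h i hi).1 t).trans (hle t), (h i hi).2.imp fun t ht => ht.trans (hle t)⟩

theorem isCausal_of_instantaneous {A B : Multiset (Pt d)} (hB : 2 ≤ B.card) {t : ℝ}
    (hAB : A.card = B.card) (ht : ∀ x ∈ A + B, x.1 = t) : IsCausal A B := by
  have htA : ∀ y ∈ A, y.1 = t := fun y hy => ht y (Multiset.mem_add.2 (Or.inl hy))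
  have htB : ∀ x ∈ B, x.1 = t := fun x hx => ht x (Multiset.mem_add.2 (Or.inr hx))
  have hB_arrived : ∀ s, t ≤ s → B.countP (fun x => x.1 ≤ s) = B.card := fun s hts =>
    Multiset.countP_eq_card.2 fun x hx => (htB x hx).le.trans hts
  have hA_present : ∀ s ≤ t, A.countP (fun y => y.1 < s) = 0 := fun s hst =>
    Multiset.countP_eq_zero.2 fun y hy => not_lt.2 (hst.trans_eq (htA y hy).symm)
  refine ⟨fun s => ?_, t, ?_⟩
  · rw [occupation]
    rcases le_total t s with hts | hst
    · have := A.countP_le_card fun y => y.1 < s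
      rw [hB_arrived s hts]
      omega
    · rw [hA_present s hst]
      omega
  · rw [occupation, hB_arrived t le_rfl, hA_present t le_rfl]
    omega

end Causal

section Measurability

variable {d N : ℕ}

theorem measurable_occupation {t : Legs d N → ℝ} (ht : Measurable t) :
    Measurable fun z : Legs d N => occupation (t z) (pts z.1) (pts z.2) := by
  simp only [occupation, countP_pts, Finset.card_filter, Nat.cast_sum, Nat.cast_ite, Nat.cast_one,
    Nat.cast_zero]
  exact (Finset.measurable_sum _ fun i _ =>
      Measurable.ite (measurableSet_le (by fun_prop) ht) measurable_const measurable_const).sub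
    (Finset.measurable_sum _ fun i _ =>
      Measurable.ite (measurableSet_lt (by fun_prop) ht) measurable_const measurable_const)

theorem measurableSet_exists_le_occupation {c : ℤ} (hc : 0 < c) :
    MeasurableSet {z : Legs d N | ∃ t, c ≤ occupation t (pts z.1) (pts z.2)} := by
  simp only [exists_le_occupation_iff_mem hc, mem_pts, exists_exists_eq_and, Set.ofPred_exists]
  exact MeasurableSet.iUnion fun b =>
    measurableSet_le measurable_const (measurable_occupation (by fun_prop))

theorem measurableSet_isCloseable (m : ℕ) :
    MeasurableSet {z : Legs d N | IsCloseable m (pts z.1) (pts z.2)} := by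
  rcases le_or_gt m N with hm | hm
  · obtain ⟨n, rfl⟩ := Nat.exists_eq_add_of_le' hm
    simp only [isCloseable_iff_forall_occupation_le (card_pts _) (card_pts _)]
    convert (measurableSet_exists_le_occupation (d := d) (N := n + m)
      (c := n + 1) (by omega)).compl using 1
    ext z
    simp
  · convert MeasurableSet.empty
    exact Set.eq_empty_of_forall_notMem fun z hz => hm.not_ge (card_pts z.2 ▸ hz.le_card)

theorem measurableSet_isCausal :
    MeasurableSet {z : Legs d N | IsCausal (pts z.1) (pts z.2)} := by
  simp only [IsCausal, forall_occupation_nonneg_iff_rat, Set.ofPred_and, Set.ofPred_forall]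
  exact (MeasurableSet.iInter fun t =>
      measurableSet_le measurable_const (measurable_occupation measurable_const)).inter
    (measurableSet_exists_le_occupation two_pos)

end Measurability

section Loop

variable {d : ℕ}

/-- The point of a leg if it is outgoing, as a multiset that is empty for incoming legs. -/
def outPoint {q : ℕ} (z : Legs d q) : Fin q ⊕ Fin q → Multiset (Pt d) :=
  Sum.elim (fun a => {z.1 a}) 0

/-- The point of a leg if it is incoming, as a multiset that is empty for outgoing legs. -/
def inPoint {q : ℕ} (z : Legs d q) : Fin q ⊕ Fin q → Multiset (Pt d) :=
  Sum.elim 0 fun b => {z.2 b}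

theorem sum_filter_ne_and_ne_add {ι M : Type*} [Fintype ι] [DecidableEq ι] [AddCommMonoid M]
    (f : ι → M) {u v : ι} (h : u ≠ v) :
    ∑ w with w ≠ u ∧ w ≠ v, f w + (f u + f v) = ∑ w, f w := by
  have hfilter : (Finset.univ.filter fun w => w ≠ u ∧ w ≠ v) = Finset.univ \ {u, v} := by
    ext; simp
  rw [hfilter, ← Finset.sum_pair h, Finset.sum_sdiff (Finset.subset_univ _)]

theorem sum_add_sum_line {r : ℕ} {M : Type*} [AddCommMonoid M] {L : Fin (r + 1) → Type*}
    [∀ i, Fintype (L i)] [∀ i, DecidableEq (L i)] (f : ∀ i, L i → M) {l ρ : ∀ i, L i}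
    (h : ∀ i, l i ≠ ρ i) :
    ∑ i, ∑ u with u ≠ l i ∧ u ≠ ρ i, f i u + ∑ i, (f i (ρ i) + f (i + 1) (l (i + 1))) =
      ∑ i, ∑ u, f i u := by
  have hshift : ∑ i, f (i + 1) (l (i + 1)) = ∑ i, f i (l i) :=
    Equiv.sum_comp (Equiv.addRight (1 : Fin (r + 1))) fun i => f i (l i)
  rw [Finset.sum_add_distrib, hshift, add_comm (∑ i, f i (ρ i)), ← Finset.sum_add_distrib,
    ← Finset.sum_add_distrib]
  exact Finset.sum_congr rfl fun i _ => sum_filter_ne_and_ne_add (f i) (h i)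

theorem sum_singleton_eq_map {ι α : Type*} (s : Finset ι) (f : ι → α) :
    ∑ i ∈ s, ({f i} : Multiset α) = s.val.map f := by
  rw [Finset.sum_eq_multiset_sum, ← Multiset.sum_map_singleton (s.val.map f), Multiset.map_map]
  rfl

theorem sum_outPoint {q : ℕ} (z : Legs d q) (p : Fin q ⊕ Fin q → Prop) [DecidablePred p] :
    ∑ u with p u, outPoint z u =
      (Finset.univ.filter fun a : Fin q => p (Sum.inl a)).val.map z.1 := by
  rw [Finset.sum_filter, Fintype.sum_sum_type]
  simp only [outPoint, Sum.elim_inl, Sum.elim_inr, Pi.zero_apply, ite_self,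
    Finset.sum_const_zero, add_zero]
  rw [← Finset.sum_filter, sum_singleton_eq_map]

theorem sum_outPoint_eq_pts {q : ℕ} (z : Legs d q) : ∑ u, outPoint z u = pts z.1 := by
  simpa only [Finset.filter_true, pts] using sum_outPoint z fun _ => True

theorem sum_inPoint {q : ℕ} (z : Legs d q) (p : Fin q ⊕ Fin q → Prop) [DecidablePred p] :
    ∑ u with p u, inPoint z u =
      (Finset.univ.filter fun b : Fin q => p (Sum.inr b)).val.map z.2 := by
  rw [Finset.sum_filter, Fintype.sum_sum_type]
  simp only [inPoint, Sum.elim_inl, Sum.elim_inr, Pi.zero_apply, ite_self,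
    Finset.sum_const_zero, zero_add]
  rw [← Finset.sum_filter, sum_singleton_eq_map]

theorem sum_inPoint_eq_pts {q : ℕ} (z : Legs d q) : ∑ u, inPoint z u = pts z.2 := by
  simpa only [Finset.filter_true, pts] using sum_inPoint z fun _ => True

/-- A propagator that runs only forward in time, and vanishes at equal times. -/
def IsRetarded (g : Pt d → Pt d → ℂ) : Prop :=
  ∀ x y, x.1 ≤ y.1 → g x y = 0

theorem Regularization.isRetarded_Gdot (P : Regularization d) {k : ℝ} (hk : 0 < k) :
    IsRetarded (P.Gdot k) := fun x y h => by
  have : (fun κ => P.G κ x y) =ᶠ[𝓝 k] fun _ => 0 := by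
    filter_upwards [lt_mem_nhds hk] with κ hκ using P.retarded κ hκ x y h
  rw [Regularization.Gdot, this.deriv_eq, deriv_const]

theorem IsRetarded.rel_of_lineFactor_ne_zero {q q' : ℕ} {g : Pt d → Pt d → ℂ} (hg : IsRetarded g)
    {z : Legs d q} {z' : Legs d q'} {u : Fin q ⊕ Fin q} {v : Fin q' ⊕ Fin q'}
    (h : lineFactor g z z' u v ≠ 0) :
    Multiset.Rel (fun y x => y.1 < x.1) (outPoint z u + outPoint z' v)
      (inPoint z u + inPoint z' v) := by
  rcases u with a | b <;> rcases v with a' | b'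
  · exact absurd rfl h
  · simp only [outPoint, inPoint, Sum.elim_inl, Sum.elim_inr, Pi.zero_apply, add_zero, zero_add]
    exact rel_singleton (not_le.1 (mt (hg _ _) h))
  · simp only [outPoint, inPoint, Sum.elim_inl, Sum.elim_inr, Pi.zero_apply, add_zero, zero_add]
    exact rel_singleton (not_le.1 (mt (hg _ _) h))
  · exact absurd rfl h

theorem card_outPoint_add_outPoint {q q' : ℕ} {g : Pt d → Pt d → ℂ}
    {z : Legs d q} {z' : Legs d q'} {u : Fin q ⊕ Fin q} {v : Fin q' ⊕ Fin q'}
    (h : lineFactor g z z' u v ≠ 0) : (outPoint z u + outPoint z' v).card = 1 := by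
  rcases u with a | b <;> rcases v with a' | b'
  · exact absurd rfl h
  · simp [outPoint]
  · simp [outPoint]
  · exact absurd rfl h

variable {r : ℕ} {q : Fin (r + 1) → ℕ} {l ρ : ∀ i, Fin (q i) ⊕ Fin (q i)}
  {z : ∀ i, Legs d (q i)}

theorem isForwardClosing_ext (hlρ : ∀ i, l i ≠ ρ i) {g : Fin (r + 1) → Pt d → Pt d → ℂ}
    (hg : ∀ i, IsRetarded (g i))
    (h : ∀ i, lineFactor (g i) (z i) (z (i + 1)) (ρ i) (l (i + 1)) ≠ 0) :
    IsForwardClosing (r + 1) (∑ i, pts (z i).1) (∑ i, pts (z i).2)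
      (extOut l ρ z) (extIn l ρ z) := by
  refine ⟨_, _, ?_, rel_sum Finset.univ fun i _ => (hg i).rel_of_lineFactor_ne_zero (h i), ?_, ?_⟩
  · simp only [Multiset.card_sum, card_outPoint_add_outPoint (h _), Finset.sum_const,
      Finset.card_univ, Fintype.card_fin, smul_eq_mul, mul_one]
  · have := sum_add_sum_line (fun i => outPoint (z i)) hlρ
    simpa only [sum_outPoint, sum_outPoint_eq_pts, extOut] using this.symm
  · have := sum_add_sum_line (fun i => inPoint (z i)) hlρ
    simpa only [sum_inPoint, sum_inPoint_eq_pts, extIn] using this.symm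

theorem add_le_sum_of_one_le (hq : ∀ i, 1 ≤ q i) (i : Fin (r + 1)) : q i + r ≤ ∑ j, q j := by
  rw [Fin.sum_univ_succAbove q i]
  simpa using Finset.card_nsmul_le_sum Finset.univ (fun j => q (i.succAbove j)) 1 fun j _ => hq _

-- Closing `m` external pairs in addition to the `r + 1` internal ones leaves `n` incoming points,
-- so at most `n` particles are ever present in the loop, let alone in one of its vertices.
theorem relevantPart_eq_self_of_loop {n m : ℕ}
    (hloop : IsForwardClosing (r + 1) (∑ i, pts (z i).1) (∑ i, pts (z i).2)
      (extOut l ρ z) (extIn l ρ z))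
    (hz : ∀ i, IsCausal (pts (z i).1) (pts (z i).2)) (hq : ∑ i, q i = n + m + (r + 1))
    (hm : IsCloseable m (extOut l ρ z) (extIn l ρ z)) (Γ : BoseFun d) (i : Fin (r + 1)) :
    relevantPart n m Γ (pts (z i).1) (pts (z i).2) = Γ (pts (z i).1) (pts (z i).2) := by
  have two_le : ∀ j, 2 ≤ q j := fun j => card_pts (z j).2 ▸ (hz j).two_le_card
  refine relevantPart_eq_self_of_occupation_le (card_pts_eq_card_pts _) (hz i).two_le_card ?_
    (fun t => ?_) Γ
  · have := add_le_sum_of_one_le (fun j => one_le_two.trans (two_le j)) i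
    rw [card_pts]
    omega
  · have total_le := (hloop.isCloseable_add hm).occupation_add_le_card t
    have vertex_le := occupation_le_occupation_sum (fun j _ => (hz j).1 t) (Finset.mem_univ i)
    simp only [Multiset.card_sum, card_pts, hq] at total_le
    push_cast at total_le
    linarith

end Loop

section Pairing

variable {d N : ℕ} {ref : ∀ N, Measure (Legs d N)}

theorem forall_mem_pts_add_pts_iff {z : Legs d N} {K : Set (Pt d)} :
    (∀ x ∈ pts z.1 + pts z.2, x ∈ K) ↔ ∀ i, z.1 i ∈ K ∧ z.2 i ∈ K := by
  simp only [Multiset.mem_add, mem_pts, or_imp, forall_and, forall_exists_index,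
    forall_apply_eq_imp_iff]

theorem measurableSet_forall_mem {K : Set (Pt d)} (hK : MeasurableSet K) :
    MeasurableSet {z : Legs d N | ∀ i, z.1 i ∈ K ∧ z.2 i ∈ K} := by
  rw [Set.ofPred_forall]
  exact MeasurableSet.iInter fun i =>
    (measurableSet_preimage (by fun_prop : Measurable fun z : Legs d N => z.1 i) hK).inter
      (measurableSet_preimage (by fun_prop : Measurable fun z : Legs d N => z.2 i) hK)

open Classical in
/-- The complex conjugate phase of `Γ` on the configurations with property `D`, and zero elsewhere.
Paired with a vertex family `Γ`, it gives the total variation of `Γ` on these configurations. -/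
noncomputable def conjPhaseOn (D : Multiset (Pt d) → Multiset (Pt d) → Prop) (Γ : BoseFun d) :
    BoseFun d := fun A B =>
  if D A B then starRingEnd ℂ (Γ A B) / ‖Γ A B‖ else 0

theorem of_conjPhaseOn_ne_zero {D : Multiset (Pt d) → Multiset (Pt d) → Prop} {Γ : BoseFun d}
    {A B : Multiset (Pt d)} (h : conjPhaseOn D Γ A B ≠ 0) : D A B := by
  by_contra hD
  exact h (if_neg hD)

open Classical in
theorem mul_conjPhaseOn (D : Multiset (Pt d) → Multiset (Pt d) → Prop) (Γ : BoseFun d)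
    (A B : Multiset (Pt d)) :
    Γ A B * conjPhaseOn D Γ A B = ((if D A B then ‖Γ A B‖ else 0 : ℝ) : ℂ) := by
  rw [conjPhaseOn]
  split_ifs
  · rw [← mul_div_assoc, Complex.mul_conj', sq, mul_self_div_self]
  · rw [mul_zero, Complex.ofReal_zero]

theorem isTest_conjPhaseOn {D : Multiset (Pt d) → Multiset (Pt d) → Prop}
    (hD : MeasurableSet {z : Legs d N | D (pts z.1) (pts z.2)}) {Γ : BoseFun d}
    (hΓ : Measurable fun z : Legs d N => Γ (pts z.1) (pts z.2)) {K : Set (Pt d)}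
    (hK : Bornology.IsBounded K) (hDK : ∀ A B, D A B → ∀ x ∈ A + B, x ∈ K) :
    IsTest N (conjPhaseOn D Γ) := by
  refine ⟨?_, ⟨1, fun A B => ?_⟩, K, hK, fun A B h => hDK A B (of_conjPhaseOn_ne_zero h)⟩
  · exact Measurable.ite hD ((Complex.continuous_conj.measurable.comp hΓ).div
      (Complex.measurable_ofReal.comp hΓ.norm)) measurable_const
  · rw [conjPhaseOn]
    split_ifs
    · rw [norm_div, RCLike.norm_conj, Complex.norm_real, norm_norm]
      exact div_self_le_one _
    · simp only [norm_zero, zero_le_one]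

theorem ae_eq_zero_of_pairing_conjPhaseOn_eq_zero {D : Multiset (Pt d) → Multiset (Pt d) → Prop}
    (hD : MeasurableSet {z : Legs d N | D (pts z.1) (pts z.2)}) {Γ : BoseFun d}
    (hΓ : IntegrableOn (fun z : Legs d N => Γ (pts z.1) (pts z.2)) {z | D (pts z.1) (pts z.2)}
      (ref N))
    (h : pairing ref N Γ (conjPhaseOn D Γ) = 0) :
    ∀ᵐ z ∂(ref N), D (pts z.1) (pts z.2) → Γ (pts z.1) (pts z.2) = 0 := by
  classical
  have factorial_ne_zero : (1 / ((N.factorial : ℂ) ^ 2)) ≠ 0 :=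
    one_div_ne_zero (pow_ne_zero _ (Nat.cast_ne_zero.2 N.factorial_ne_zero))
  have integral_norm : ∫ z in {z : Legs d N | D (pts z.1) (pts z.2)},
      ‖Γ (pts z.1) (pts z.2)‖ ∂(ref N) = 0 := by
    have := (mul_eq_zero.1 h).resolve_left factorial_ne_zero
    simp only [mul_conjPhaseOn] at this
    rw [integral_complex_ofReal, Complex.ofReal_eq_zero] at this
    rw [← this, ← integral_indicator hD]
    rfl
  rw [integral_eq_zero_iff_of_nonneg (fun _ => norm_nonneg _) hΓ.norm, EventuallyEq,
    ae_restrict_iff' hD] at integral_norm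
  filter_upwards [integral_norm] with z hz hDz using norm_eq_zero.1 (hz hDz)

theorem ae_eq_zero_of_pairing_eq_zero {D : Multiset (Pt d) → Multiset (Pt d) → Prop}
    (hD : MeasurableSet {z : Legs d N | D (pts z.1) (pts z.2)}) {Γ : BoseFun d}
    (hΓ : IsVertexFamily ref Γ)
    (h : ∀ ψ, IsTest N ψ → (∀ A B, ψ A B ≠ 0 → D A B) → pairing ref N Γ ψ = 0) :
    ∀ᵐ z ∂(ref N), D (pts z.1) (pts z.2) → Γ (pts z.1) (pts z.2) = 0 := by
  let ball (R : ℕ) : Set (Pt d) := Metric.closedBall 0 R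
  let DR (R : ℕ) (A B : Multiset (Pt d)) : Prop := D A B ∧ ∀ x ∈ A + B, x ∈ ball R
  have measurableSet_DR (R : ℕ) : MeasurableSet {z : Legs d N | DR R (pts z.1) (pts z.2)} := by
    simp only [DR, forall_mem_pts_add_pts_iff]
    exact hD.inter (measurableSet_forall_mem Metric.isClosed_closedBall.measurableSet)
  have eq_zero_in_ball (R : ℕ) :
      ∀ᵐ z ∂(ref N), DR R (pts z.1) (pts z.2) → Γ (pts z.1) (pts z.2) = 0 := by
    refine ae_eq_zero_of_pairing_conjPhaseOn_eq_zero (measurableSet_DR R) ?_ (h _ ?_ ?_)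
    · exact ((hΓ N).2 (ball R) Metric.isBounded_closedBall).mono_set
        fun z hz => forall_mem_pts_add_pts_iff.1 hz.2
    · exact isTest_conjPhaseOn (measurableSet_DR R) (hΓ N).1 Metric.isBounded_closedBall
        fun _ _ hAB => hAB.2
    · exact fun _ _ hne => (of_conjPhaseOn_ne_zero hne).1
  filter_upwards [ae_all_iff.2 eq_zero_in_ball] with z hz hDz
  obtain ⟨R, hR⟩ := exists_nat_ge ‖z‖
  refine hz R ⟨hDz, forall_mem_pts_add_pts_iff.2 fun i => ?_⟩
  simp only [ball, mem_closedBall_zero_iff]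
  exact ⟨((norm_le_pi_norm z.1 i).trans (norm_fst_le z)).trans hR,
    ((norm_le_pi_norm z.2 i).trans (norm_snd_le z)).trans hR⟩

theorem pairing_closeablePart (N m : ℕ) (Γ ψ : BoseFun d) :
    pairing ref N (closeablePart m Γ) ψ = pairing ref N Γ (closeablePart m ψ) := by
  simp only [pairing, closeablePart, ite_mul, mul_ite, zero_mul, mul_zero]

theorem IsTest.closeablePart {ψ : BoseFun d} (hψ : IsTest N ψ) (m : ℕ) :
    IsTest N (closeablePart m ψ) := by
  obtain ⟨hmeas, ⟨C, hC⟩, K, hK, hsupp⟩ := hψ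
  refine ⟨?_, ⟨C, fun A B => ?_⟩, K, hK, fun A B hne => hsupp A B fun h0 => hne ?_⟩
  · exact Measurable.ite ((measurableSet_isCloseable m).inter
      (measurableSet_isCloseable (m + 1)).compl) hmeas measurable_const
  · rw [VacuumFRG.closeablePart]
    split_ifs
    · exact hC A B
    · simpa only [norm_zero] using (norm_nonneg _).trans (hC A B)
  · rw [VacuumFRG.closeablePart, h0, ite_self]

/-- The vertices of one or more bodies vanish almost everywhere outside the causal
configurations. -/
def IsCausallySupported (ref : ∀ N, Measure (Legs d N)) (Γ : BoseFun d) : Prop :=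
  ∀ N, 1 ≤ N → ∀ᵐ z ∂(ref N), Γ (pts z.1) (pts z.2) ≠ 0 → IsCausal (pts z.1) (pts z.2)

theorem IsMicroscopic.isCausallySupported {S : BoseFun d} (hS : IsMicroscopic ref S) :
    IsCausallySupported ref S := fun _ _ => Eventually.of_forall fun _ hz => by
  obtain ⟨hAB, two_le, t, ht⟩ := hS.instantaneous _ _ hz
  exact isCausal_of_instantaneous (hAB ▸ two_le) hAB ht

theorem IsVertexFamily.isCausallySupported {Γ : BoseFun d} (hΓ : IsVertexFamily ref Γ)
    (h : ∀ N, 1 ≤ N → ∀ ψ, IsTest N ψ → (∀ A B, ψ A B ≠ 0 → ¬ IsCausal A B) →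
      pairing ref N Γ ψ = 0) :
    IsCausallySupported ref Γ := fun N hN => by
  filter_upwards [ae_eq_zero_of_pairing_eq_zero measurableSet_isCausal.compl hΓ (h N hN)]
    with z hz using not_imp_comm.1 hz

theorem IsCausallySupported.pairing_eq_zero {Γ ψ : BoseFun d} (hΓ : IsCausallySupported ref Γ)
    (hN : 1 ≤ N) (hψ : ∀ A B, ψ A B ≠ 0 → ¬ IsCausal A B) : pairing ref N Γ ψ = 0 := by
  rw [pairing, integral_eq_zero_of_ae, mul_zero]
  filter_upwards [hΓ N hN] with z hz
  by_contra hne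
  obtain ⟨hΓz, hψz⟩ := mul_ne_zero_iff.1 hne
  exact hψ _ _ hψz (hz hΓz)

end Pairing

section Flow

variable {d : ℕ} {ref : ∀ N, Measure (Legs d N)} [∀ N, SigmaFinite (ref N)]
  {P : Regularization d} {k : ℝ}

theorem one_le_of_leg {q : ℕ} (u : Fin q ⊕ Fin q) : 1 ≤ q :=
  (u.elim id id).pos

theorem ae_forall_pi {ι : Type*} [Fintype ι] {X : ι → Type*} [∀ i, MeasurableSpace (X i)]
    {μ : ∀ i, Measure (X i)} [∀ i, SigmaFinite (μ i)] {p : ∀ i, X i → Prop}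
    (h : ∀ i, ∀ᵐ x ∂μ i, p i x) : ∀ᵐ x ∂Measure.pi μ, ∀ i, p i (x i) :=
  eventually_all.2 fun i => Measure.tendsto_eval_ae_ae.eventually (h i)

theorem isRetarded_line (hk : 0 < k) {ι : Type*} [DecidableEq ι] (e i : ι) :
    IsRetarded (if i = e then P.Gdot k else P.G k) := by
  split_ifs
  · exact P.isRetarded_Gdot hk
  · exact P.retarded k hk

section Diagram

variable {r : ℕ} {q : Fin (r + 1) → ℕ} {l ρ : ∀ i, Fin (q i) ⊕ Fin (q i)}

theorem IsCausallySupported.ae_forall_isCausal {Γ : BoseFun d} (hΓ : IsCausallySupported ref Γ)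
    (l : ∀ i, Fin (q i) ⊕ Fin (q i)) :
    ∀ᵐ z ∂(Measure.pi fun i => ref (q i)), ∏ i, Γ (pts (z i).1) (pts (z i).2) ≠ 0 →
      ∀ i, IsCausal (pts (z i).1) (pts (z i).2) := by
  filter_upwards [ae_forall_pi fun i => hΓ (q i) (one_le_of_leg (l i))] with z hz hne i
  exact hz i (Finset.prod_ne_zero_iff.1 hne i (Finset.mem_univ i))

theorem loopDiagram_congr (hk : 0 < k) (hlρ : ∀ i, l i ≠ ρ i) {Γ Γ' ψ ψ' : BoseFun d}
    (h : ∀ᵐ z ∂(Measure.pi fun i => ref (q i)),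
      IsForwardClosing (r + 1) (∑ i, pts (z i).1) (∑ i, pts (z i).2)
        (extOut l ρ z) (extIn l ρ z) →
      (∏ i, Γ (pts (z i).1) (pts (z i).2)) * ψ (extOut l ρ z) (extIn l ρ z) =
        (∏ i, Γ' (pts (z i).1) (pts (z i).2)) * ψ' (extOut l ρ z) (extIn l ρ z))
    (e : Fin (r + 1)) :
    loopDiagram P ref k Γ ψ r q l ρ e = loopDiagram P ref k Γ' ψ' r q l ρ e := by
  refine integral_congr_ae ?_
  filter_upwards [h] with z hz
  rw [mul_right_comm, mul_right_comm (∏ i, Γ' _ _)]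
  by_cases hlines : ∏ i, lineFactor (if i = e then P.Gdot k else P.G k) (z i) (z (i + 1))
      (ρ i) (l (i + 1)) = 0
  · rw [hlines, mul_zero, mul_zero]
  · rw [hz (isForwardClosing_ext hlρ (isRetarded_line hk e) fun i =>
      Finset.prod_ne_zero_iff.1 hlines i (Finset.mem_univ i))]

theorem prod_relevantPart_eq {n m : ℕ} {z : ∀ i, Legs d (q i)} {Γ : BoseFun d}
    (hz : ∏ i, Γ (pts (z i).1) (pts (z i).2) ≠ 0 → ∀ i, IsCausal (pts (z i).1) (pts (z i).2))
    (hloop : IsForwardClosing (r + 1) (∑ i, pts (z i).1) (∑ i, pts (z i).2)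
      (extOut l ρ z) (extIn l ρ z))
    (hq : ∑ i, q i = n + m + (r + 1)) (hm : IsCloseable m (extOut l ρ z) (extIn l ρ z)) :
    ∏ i, relevantPart n m Γ (pts (z i).1) (pts (z i).2) =
      ∏ i, Γ (pts (z i).1) (pts (z i).2) := by
  by_cases hΓ : ∏ i, Γ (pts (z i).1) (pts (z i).2) = 0
  · obtain ⟨i, hi, hΓi⟩ := Finset.prod_eq_zero_iff.1 hΓ
    rw [hΓ, Finset.prod_eq_zero hi]
    rw [relevantPart, hΓi, ite_self]
  · exact Finset.prod_congr rfl fun i _ => relevantPart_eq_self_of_loop hloop (hz hΓ) hq hm Γ i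

end Diagram

variable {Γ Γ' ψ ψ' : BoseFun d} {N n m : ℕ}

theorem flowRHS_congr
    (h : ∀ (r : ℕ) (q : Fin (r + 1) → ℕ), ∑ i, q i = N + (r + 1) →
      ∀ l ρ : ∀ i, Fin (q i) ⊕ Fin (q i), (∀ i, l i ≠ ρ i) → ∀ e,
        loopDiagram P ref k Γ ψ r q l ρ e = loopDiagram P ref k Γ' ψ' r q l ρ e) :
    flowRHS P ref k Γ N ψ = flowRHS P ref k Γ' N ψ' := by
  refine tsum_congr fun r => congrArg (HMul.hMul _) ?_
  refine Finset.sum_congr rfl fun q hq => congrArg (HMul.hMul _) ?_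
  refine Finset.sum_congr rfl fun l _ => Finset.sum_congr rfl fun ρ _ => ?_
  split_ifs with hlρ
  · exact Finset.sum_congr rfl fun e _ => h r q (Finset.mem_piAntidiag.1 hq).1 l ρ hlρ e
  · rfl

theorem flowRHS_congr_ae (ψ : BoseFun d)
    (h : ∀ q, ∀ᵐ z ∂(ref q), Γ (pts z.1) (pts z.2) = Γ' (pts z.1) (pts z.2)) :
    flowRHS P ref k Γ N ψ = flowRHS P ref k Γ' N ψ := by
  refine flowRHS_congr fun r q _ l ρ _ e => integral_congr_ae ?_
  filter_upwards [ae_forall_pi fun i => h (q i)] with z hz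
  simp only [hz]

theorem flowRHS_zero_right : flowRHS P ref k Γ N 0 = 0 := by
  simp [flowRHS, loopDiagram]

theorem flowRHS_eq_zero_of_not_isCausal (hk : 0 < k) (hΓ : IsCausallySupported ref Γ)
    (hψ : ∀ A B, ψ A B ≠ 0 → ¬ IsCausal A B) : flowRHS P ref k Γ N ψ = 0 := by
  rw [← flowRHS_zero_right (ref := ref) (P := P) (k := k) (Γ := Γ) (N := N)]
  refine flowRHS_congr fun r q _ l ρ hlρ => loopDiagram_congr hk hlρ ?_
  filter_upwards [hΓ.ae_forall_isCausal l] with z hz hloop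
  by_contra hne
  simp only [Pi.zero_apply, mul_zero] at hne
  obtain ⟨hΓz, hψz⟩ := mul_ne_zero_iff.1 hne
  exact hψ _ _ hψz (hloop.isCausal (isCausal_sum Finset.univ_nonempty fun i _ => hz hΓz i))

theorem flowRHS_relevantPart (hk : 0 < k) (hΓ : IsCausallySupported ref Γ)
    (hψ : ∀ A B, ψ A B ≠ 0 → IsCloseable m A B) :
    flowRHS P ref k (relevantPart n m Γ) (n + m) ψ = flowRHS P ref k Γ (n + m) ψ := by
  refine flowRHS_congr fun r q hq l ρ hlρ => loopDiagram_congr hk hlρ ?_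
  filter_upwards [hΓ.ae_forall_isCausal l] with z hz hloop
  by_cases hψz : ψ (extOut l ρ z) (extIn l ρ z) = 0
  · rw [hψz, mul_zero, mul_zero]
  · rw [prod_relevantPart_eq hz hloop hq (hψ _ _ hψz)]

theorem FlowGenerated.isCausallySupported {S : BoseFun d} (hS : IsMicroscopic ref S)
    (hΓ : FlowGenerated P ref S Γ) : IsCausallySupported ref Γ := by
  induction hΓ with
  | micro => exact hS.isCausallySupported
  | step Γ Γ' k ε hk _ hΓ' hstep ih =>
    refine hΓ'.isCausallySupported fun N hN ψ hψ hc => ?_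
    rw [hstep N hN ψ hψ, ih.pairing_eq_zero hN hc, flowRHS_eq_zero_of_not_isCausal hk ih hc,
      mul_zero, add_zero]
  | limit Γs Γ _ hΓ hlim ih =>
    refine hΓ.isCausallySupported fun N hN ψ hψ hc => tendsto_nhds_unique (hlim N hN ψ hψ) ?_
    simp only [fun i => (ih i).pairing_eq_zero hN hc]
    exact tendsto_const_nhds

end Flow


end VacuumFRG

theorem theorem1 {d : ℕ} (P : VacuumFRG.Regularization d)
    (ref : ∀ N, MeasureTheory.Measure (VacuumFRG.Legs d N))
    [∀ N, MeasureTheory.SigmaFinite (ref N)]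
    (n m : ℕ) (hnm : 1 ≤ n + m) :
    -- the flow equation of the `m`-closeable part of the `(n + m)`-body vertex
    (∀ (S : VacuumFRG.BoseFun d) (Γ : ℝ → VacuumFRG.BoseFun d), VacuumFRG.IsFlow P ref S Γ →
      ∀ k, 0 < k → ∀ ψ, VacuumFRG.IsTest (n + m) ψ →
        HasDerivAt
          (fun κ => VacuumFRG.pairing ref (n + m) (VacuumFRG.closeablePart m (Γ κ)) ψ)
          (VacuumFRG.flowRHS P ref k (VacuumFRG.relevantPart n m (Γ k)) (n + m)
            (VacuumFRG.closeablePart m ψ)) k) ∧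
    -- its right-hand side is the same for any two families of vertices that share these parts
    (∀ S S' Γ Γ' : VacuumFRG.BoseFun d,
      VacuumFRG.IsMicroscopic ref S → VacuumFRG.FlowGenerated P ref S Γ →
      VacuumFRG.IsMicroscopic ref S' → VacuumFRG.FlowGenerated P ref S' Γ' →
      (∀ q, ∀ᵐ z ∂(ref q),
        VacuumFRG.relevantPart n m Γ (VacuumFRG.pts z.1) (VacuumFRG.pts z.2) =
          VacuumFRG.relevantPart n m Γ' (VacuumFRG.pts z.1) (VacuumFRG.pts z.2)) →
      ∀ k, 0 < k → ∀ ψ, VacuumFRG.IsTest (n + m) ψ →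
        VacuumFRG.flowRHS P ref k Γ (n + m) (VacuumFRG.closeablePart m ψ) =
          VacuumFRG.flowRHS P ref k Γ' (n + m) (VacuumFRG.closeablePart m ψ)) := by
  refine ⟨fun S Γ hΓ k hk ψ hψ => ?_, fun S S' Γ Γ' hS hΓ hS' hΓ' h k hk ψ _ => ?_⟩
  · have hsupp := (hΓ.generated k hk).isCausallySupported hΓ.isMicroscopic
    rw [VacuumFRG.flowRHS_relevantPart hk hsupp
      fun _ _ => VacuumFRG.isCloseable_of_closeablePart_ne_zero]
    simp only [VacuumFRG.pairing_closeablePart]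
    exact hΓ.flow (n + m) hnm _ (hψ.closeablePart m) k hk
  · rw [← VacuumFRG.flowRHS_relevantPart hk (hΓ.isCausallySupported hS)
        fun _ _ => VacuumFRG.isCloseable_of_closeablePart_ne_zero,
      ← VacuumFRG.flowRHS_relevantPart hk (hΓ'.isCausallySupported hS')
        fun _ _ => VacuumFRG.isCloseable_of_closeablePart_ne_zero]
    exact VacuumFRG.flowRHS_congr_ae _ h
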